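/- Let $\beta\in(0,1)$, $k\ge 1$, $\lambda_1,\dots,\lambda_k>0$. Let $\mathcal N$ be a generalized counting process with jumps of sizes $1,\dots,k$ at rates $\lambda_1,\dots,\lambda_k$ (a Lévy process whose value at time $t$ is distributed as $\sum_{i=1}^k iX_i$ with independent Poisson variables $X_i$ of means $\lambda_i t$), let $S_\beta$ be an independent $\beta$-stable subordinator, $\mathbb E[e^{-uS_\beta(t)}]=e^{-tu^\beta}$ for $u>0$, with inverse $\mathcal W_\beta(t)=\inf\{r\ge0: S_\beta(r)>t\}$, and let $\mathcal N^\beta(t)=\mathcal N(\mathcal W_\beta(t))$ be the generalized fractional counting process. Let $Y_1,Y_2,\dots$ be i.i.d. random variables with mean $\mu>0$ and finite variance, independent of $\mathcal N^\beta$, and let $\eta>0$. For an initial capital $u\ge 0$ consider the risk process (AGFRP) $$\underline R^\beta(t)=u+\eta t-\sum_{j=1}^{\mathcal N^\beta(t)}Y_j,\qquad t\ge0,$$ and its finite-time ruin probability $\Psi(u,t)=\Pr\{\underline R^\beta(s)<0\text{ for some }s\le t\}$. Suppose that the claims are light-tailed, that is, the moment generating function $H_Y(\xi)=\mathbb E[e^{\xi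 Y_1}]$ is finite for some $\xi>0$. Let $\Gamma(y_0)=\min_{y>0}\Gamma(y)\approx 0.8856$. Let $t>0$, and suppose that there is a $\xi>0$ with $H_Y(\xi)<\infty$ and $$\sum_{i=1}^k\lambda_i H_Y(\xi)^i\ \ge\ \sum_{i=1}^k\lambda_i+\frac{2\Gamma(y_0)-1}{2t^\beta\,\Gamma(y_0)}$$ (this holds for every $t>0$ if $H_Y$ is unbounded on the set of $\xi>0$ where it is finite, for instance if $H_Y$ is finite everywhere or the claims are exponentially distributed). Then the equation $$\sum_{i=1}^k\lambda_i H_Y(\xi)^i=\sum_{i=1}^k\lambda_i+\frac{2\Gamma(y_0)-1}{2t^\beta\,\Gamma(y_0)}$$ has a unique positive root $\xi_0=\xi_0(t,\beta,\lambda_1,\dots,\lambda_k)$ (with $H_Y(\xi_0)<\infty$), and $$\tfrac12\,\Psi(u,t)\le e^{-u\xi_0}\qquad\text{for all }u\ge0.$$ -/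

import Mathlib

open MeasureTheory ProbabilityTheory Set
open scoped NNReal

noncomputable section

/-- A `β`-stable subordinator `(S(t))_{t ≥ 0}`: a Lévy process started at `0` with non-decreasing
right-continuous paths and Laplace transform `E[exp(-u S(t))] = exp(-t u^β)`. -/
structure IsStableSubordinator {Ω : Type*} [MeasurableSpace Ω] (β : ℝ) (S : ℝ≥0 → Ω → ℝ)
    (P : Measure Ω) : Prop where
  measurable : ∀ t, Measurable (S t)
  zero : ∀ᵐ ω ∂P, S 0 ω = 0
  monotone : ∀ᵐ ω ∂P, Monotone fun t => S t ω
  rightCont : ∀ᵐ ω ∂P, ∀ t, ContinuousWithinAt (fun r => S r ω) (Ici t) t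
  indep : HasIndepIncrements S P
  stationary : ∀ s t, IdentDistrib (fun ω => S (s + t) ω - S s ω) (S t) P P
  laplace : ∀ (t : ℝ≥0) (u : ℝ), 0 < u →
    ∫ ω, Real.exp (-u * S t ω) ∂P = Real.exp (-(t : ℝ) * u ^ β)

/-- The inverse subordinator (first passage time) `W(t) = inf {r ≥ 0 : S(r) > t}`. -/
def inverseSubordinator {Ω : Type*} (S : ℝ≥0 → Ω → ℝ) (t : ℝ≥0) (ω : Ω) : ℝ≥0 :=
  sInf {r : ℝ≥0 | (t : ℝ) < S r ω}

/-- The law at time `t` of a counting process with jumps of sizes `1, …, k` arriving at rates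
`λ₁, …, λ_k`: the law of `∑ i X_i` with `X_i` independent Poisson variables of means `λ_i t`, i.e.
`P(n) = ∑_{j₁ + 2 j₂ + ⋯ + k j_k = n} ∏ (λ_i t)^{j_i} / j_i! · exp(-(λ₁ + ⋯ + λ_k) t)`.
The rate of the jumps of size `i + 1` is `lam i`, for `i : Fin k`. -/
def gcpLaw {k : ℕ} (lam : Fin k → ℝ≥0) (t : ℝ≥0) : Measure ℕ :=
  (Measure.pi fun i => poissonMeasure (lam i * t)).map fun x => ∑ i : Fin k, ((i : ℕ) + 1) * x i

/-- A generalized counting process with jumps of sizes `1, …, k` at rates `λ₁, …, λ_k`. The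
subtraction of natural numbers is the true increment, the paths being non-decreasing. -/
structure IsGCP {Ω : Type*} [MeasurableSpace Ω] {k : ℕ} (lam : Fin k → ℝ≥0) (N : ℝ≥0 → Ω → ℕ)
    (P : Measure Ω) : Prop where
  measurable : ∀ t, Measurable (N t)
  zero : ∀ᵐ ω ∂P, N 0 ω = 0
  monotone : ∀ᵐ ω ∂P, Monotone fun t => N t ω
  rightCont : ∀ᵐ ω ∂P, ∀ t, ContinuousWithinAt (fun r => N r ω) (Ici t) t
  indep : HasIndepIncrements N P
  law : ∀ s t, P.map (fun ω => N (s + t) ω - N s ω) = gcpLaw lam t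

/-- The generalized fractional counting process `N^β(t) = N(W_β(t))`. -/
def gfcp {Ω : Type*} (N : ℝ≥0 → Ω → ℕ) (S : ℝ≥0 → Ω → ℝ) (t : ℝ≥0) (ω : Ω) : ℕ :=
  N (inverseSubordinator S t ω) ω

/-- The risk process `R(t) = u + η t - ∑_{j = 1}^{M(t)} Y_j` with initial capital `u`, premium rate
`η`, claim-number process `M` and claims `Y` (numbered from `0`). -/
def riskProcess {Ω : Type*} (u η : ℝ) (M : ℝ≥0 → Ω → ℕ) (Y : ℕ → Ω → ℝ) (t : ℝ≥0) (ω : Ω) : ℝ :=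
  u + η * t - ∑ j ∈ Finset.range (M t ω), Y j ω

/-- The finite-time ruin probability `Ψ(u,t) = P(R(s) < 0 for some s ≤ t)`. -/
def ruinProb {Ω : Type*} [MeasurableSpace Ω] (P : Measure Ω) (η : ℝ) (M : ℝ≥0 → Ω → ℕ)
    (Y : ℕ → Ω → ℝ) (u : ℝ) (t : ℝ≥0) : ℝ :=
  P.real {ω | ∃ s ≤ t, riskProcess u η M Y s ω < 0}

/-- `Z` is light-tailed: its moment generating function is finite at some positive point. -/
def IsLightTailed {Ω : Type*} [MeasurableSpace Ω] (Z : Ω → ℝ) (P : Measure Ω) : Prop :=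
  ∃ ξ : ℝ, 0 < ξ ∧ Integrable (fun ω => Real.exp (ξ * Z ω)) P

/-- `Γ(y₀) ≈ 0.8856`, the minimum of the Gamma function over the positive reals. -/
def gammaMin : ℝ := sInf (Real.Gamma '' Ioi 0)

/-- The left-hand side `∑ λ_i H(ξ)^i` of the equation for the exponent, `H` being the moment
generating function of the claim `Z`. -/
def rateMgfSum {Ω : Type*} [MeasurableSpace Ω] {k : ℕ} (lam : Fin k → ℝ≥0) (Z : Ω → ℝ)
    (P : Measure Ω) (ξ : ℝ) : ℝ :=
  ∑ i : Fin k, (lam i : ℝ) * mgf Z P ξ ^ ((i : ℕ) + 1)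

/-- The right-hand side `∑ λ_i + (2 Γ(y₀) - 1) / (2 t^β Γ(y₀))` of the equation. -/
def ruinLevel {k : ℕ} (lam : Fin k → ℝ≥0) (β : ℝ) (t : ℝ≥0) : ℝ :=
  ∑ i : Fin k, (lam i : ℝ) + (2 * gammaMin - 1) / (2 * (t : ℝ) ^ β * gammaMin)

/-- `ξ` is a positive root of `∑ λ_i H(ξ)^i = ∑ λ_i + (2 Γ(y₀) - 1) / (2 t^β Γ(y₀))`. -/
def IsRuinExponent {Ω : Type*} [MeasurableSpace Ω] {k : ℕ} (lam : Fin k → ℝ≥0) (β : ℝ) (t : ℝ≥0)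
    (Z : Ω → ℝ) (P : Measure Ω) (ξ : ℝ) : Prop :=
  0 < ξ ∧ Integrable (fun ω => Real.exp (ξ * Z ω)) P ∧ rateMgfSum lam Z P ξ = ruinLevel lam β t

end

open scoped ENNReal Topology

/-! Premiums only help, so ruin by time `t` forces the claim walk to exceed `u` within its first
`N^β(t)` steps. For `ξ > 0` put `H = E[exp (ξ Y)]`, which exceeds `1` because the mean is positive.
Freezing the walk after its first passage and applying Markov's inequality bounds the probability of
passage within `m` steps by `e^{-uξ} H^m`. Averaging over the independent claim number gives `Ψ(u,t)
≤ e^{-uξ} E[H^{N^β(t)}]` (`measure_ruin_le`).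

Conditioning on the random time `W = W_β(t)` gives `E[H^{N(W)}] ≤ E[e^{cW}]` with `c = ∑ λ_i (H^i -
1)` (`IsGCP.lintegral_pow_comp_le`). The moments satisfy `E[W^n] ≤ n! t^{nβ} / Γ(nβ+1)`, and `Γ ≥
Γ(y₀)`, so `E[e^{cW}]` is at most the geometric sum `1 / (Γ(y₀) (1 - c t^β))`
(`IsStableSubordinator.lintegral_exp_inverse_le`). The equation for `ξ₀` says exactly that this
bound equals `2`.

The moment bound rests on `IsStableSubordinator.bind_rpowMeasure`: mixing the laws of `S(r)` with
weight `r^{p-1} dr` gives a multiple of `x^{pβ-1} dx`, by uniqueness of Laplace transforms. The root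
exists by the intermediate value theorem and is unique because convexity and the positive mean make
`H` strictly increasing. -/

theorem gammaMin_le_Gamma {y : ℝ} (hy : 0 < y) : gammaMin ≤ Real.Gamma y :=
  csInf_le ⟨0, by rintro _ ⟨x, hx, rfl⟩; exact (Real.Gamma_pos_of_pos hx).le⟩ ⟨y, hy, rfl⟩

/-- The minimiser `x` lies between `1` and `2`, and `x Γ(x) = Γ(x+1) ≥ Γ(2) = 1`, so `Γ(x) ≥ 1/x >
1/2`. This makes the extra term in `ruinLevel` positive. -/
theorem half_lt_gammaMin : 1 / 2 < gammaMin := by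
  obtain ⟨x, hx, hmin⟩ := Real.exists_isMinOn_Gamma_Ioi
  have hx0 : 0 < x := by linarith [hx.1]
  have h1 : Real.Gamma x ≤ gammaMin :=
    le_csInf ⟨_, 1, by simp, rfl⟩ (by rintro _ ⟨y, hy, rfl⟩; exact hmin hy)
  have h2 : Real.Gamma 2 ≤ Real.Gamma (x + 1) :=
    Real.Gamma_strictMonoOn_Ici.monotoneOn (by simp) (by simp; linarith [hx.1])
      (by linarith [hx.1])
  rw [Real.Gamma_two, Real.Gamma_add_one hx0.ne'] at h2
  nlinarith [hx.2, Real.Gamma_pos_of_pos hx0]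

/-! ### Uniqueness of Laplace transforms -/

/-- Finite measures on the line whose moment generating functions exist and agree on an open
convex set containing `0` are equal. -/
theorem measure_ext_of_mgf_eqOn {μ ν : Measure ℝ} [IsFiniteMeasure μ] [IsFiniteMeasure ν]
    {s : Set ℝ} (hs : IsOpen s) (hsc : Convex ℝ s) (h0 : 0 ∈ s)
    (hμ : s ⊆ integrableExpSet id μ) (hν : s ⊆ integrableExpSet id ν)
    (h : EqOn (mgf id μ) (mgf id ν) s) : μ = ν := by
  have hX : AnalyticOnNhd ℂ (complexMGF id μ) {z | z.re ∈ s} :=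
    analyticOnNhd_complexMGF.mono fun z hz => interior_maximal hμ hs hz
  have hY : AnalyticOnNhd ℂ (complexMGF id ν) {z | z.re ∈ s} :=
    analyticOnNhd_complexMGF.mono fun z hz => interior_maximal hν hs hz
  -- Identity theorem on the vertical strip over `s`: agreement at real points near `0` spreads to
  -- the imaginary axis, where the values are the characteristic functions.
  have key : EqOn (complexMGF id μ) (complexMGF id ν) {z | z.re ∈ s} := by
    refine AnalyticOnNhd.eqOn_of_preconnected_of_frequently_eq hX hY
      (hsc.linear_preimage Complex.reLm).isPreconnected (z₀ := ((0 : ℝ) : ℂ)) (by simpa using h0) ?_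
    have h_real : ∃ᶠ x : ℝ in 𝓝[≠] 0, complexMGF id μ x = complexMGF id ν x := by
      refine Filter.Eventually.frequently ?_
      filter_upwards [nhdsWithin_le_nhds (hs.mem_nhds h0)] with y hy
      rw [complexMGF_ofReal, complexMGF_ofReal, h hy]
    rw [Filter.frequently_iff_seq_forall] at h_real ⊢
    obtain ⟨xs, hx_tendsto, hx_eq⟩ := h_real
    refine ⟨fun n => xs n, ?_, hx_eq⟩
    rw [tendsto_nhdsWithin_iff] at hx_tendsto ⊢
    exact ⟨(Complex.continuous_ofReal.tendsto 0).comp hx_tendsto.1, by simpa using hx_tendsto.2⟩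
  refine Measure.ext_of_charFun (funext fun x => ?_)
  rw [← complexMGF_id_mul_I, ← complexMGF_id_mul_I]
  exact key (by simpa using h0)

/-- Measures on the line are determined by their Laplace transforms on the positive half-line. -/
theorem measure_ext_of_laplace {μ ν : Measure ℝ}
    (h : ∀ s : ℝ, 0 < s → ∫⁻ x, ENNReal.ofReal (Real.exp (-(s * x))) ∂μ =
      ∫⁻ x, ENNReal.ofReal (Real.exp (-(s * x))) ∂ν)
    (hfin : ∀ s : ℝ, 0 < s → ∫⁻ x, ENNReal.ofReal (Real.exp (-(s * x))) ∂ν ≠ ⊤) : μ = ν := by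
  -- Tilting by `e^{-x}` makes both measures finite and turns the Laplace transform at `1 - w` into
  -- the moment generating function at `w`, so the two agree on `w < 1`, a neighbourhood of `0`. The
  -- tilt is undone at the end.
  set d : ℝ → ℝ≥0∞ := fun x => ENNReal.ofReal (Real.exp (-(1 * x))) with hd
  have hdm : Measurable d := by fun_prop
  have hlin : ∀ (m : Measure ℝ) (w : ℝ),
      ∫⁻ x, ENNReal.ofReal (Real.exp (w * x)) ∂(m.withDensity d) =
        ∫⁻ x, ENNReal.ofReal (Real.exp (-((1 - w) * x))) ∂m := by
    intro m w
    rw [lintegral_withDensity_eq_lintegral_mul _ hdm (by fun_prop)]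
    refine lintegral_congr fun x => ?_
    simp only [Pi.mul_apply, hd]
    rw [← ENNReal.ofReal_mul (Real.exp_pos _).le, ← Real.exp_add]
    congr 2
    ring
  have hint : ∀ (m : Measure ℝ) (w : ℝ),
      ∫⁻ x, ENNReal.ofReal (Real.exp (-((1 - w) * x))) ∂m ≠ ⊤ →
        w ∈ integrableExpSet id (m.withDensity d) := by
    intro m w hw
    refine ⟨by fun_prop, ?_⟩
    rw [hasFiniteIntegral_iff_ofReal (Filter.Eventually.of_forall fun x => (Real.exp_pos _).le)]
    simp only [id]
    rw [hlin]
    exact hw.lt_top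
  have hmgf : ∀ (m : Measure ℝ) (w : ℝ), mgf id (m.withDensity d) w =
      (∫⁻ x, ENNReal.ofReal (Real.exp (-((1 - w) * x))) ∂m).toReal := by
    intro m w
    rw [mgf, integral_eq_lintegral_of_nonneg_ae
      (Filter.Eventually.of_forall fun x => (Real.exp_pos _).le) (by fun_prop)]
    simp only [id]
    rw [hlin]
  have hfinite : ∀ m : Measure ℝ, ∫⁻ x, ENNReal.ofReal (Real.exp (-(1 * x))) ∂m ≠ ⊤ →
      IsFiniteMeasure (m.withDensity d) := fun m hm => isFiniteMeasure_withDensity hm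
  have := hfinite ν (hfin 1 one_pos)
  have := hfinite μ (by rw [h 1 one_pos]; exact hfin 1 one_pos)
  have heq : μ.withDensity d = ν.withDensity d := by
    refine measure_ext_of_mgf_eqOn (s := Iio 1) isOpen_Iio (convex_Iio 1) (by simp) ?_ ?_ ?_
    · intro w hw
      have hw' : 0 < 1 - w := sub_pos.2 hw
      exact hint _ _ (by rw [h _ hw']; exact hfin _ hw')
    · exact fun w hw => hint _ _ (hfin _ (sub_pos.2 hw))
    · intro w hw
      rw [hmgf, hmgf, h _ (sub_pos.2 hw)]
  have hinv : ∀ m : Measure ℝ, (m.withDensity d).withDensity (fun x => (d x)⁻¹) = m := fun m =>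
    withDensity_inv_same hdm (Filter.Eventually.of_forall fun x => by simp [hd, Real.exp_pos])
      (Filter.Eventually.of_forall fun x => ENNReal.ofReal_ne_top)
  rw [← hinv μ, heq, hinv]

/-! ### Power weights on the half-line -/

/-- The measure `x^(p-1) dx` on the positive half-line. -/
noncomputable def rpowMeasure (p : ℝ) : Measure ℝ :=
  (volume.restrict (Ioi 0)).withDensity fun x => ENNReal.ofReal (x ^ (p - 1))

theorem lintegral_rpowMeasure (p : ℝ) {f : ℝ → ℝ≥0∞} (hf : Measurable f) :
    ∫⁻ x, f x ∂(rpowMeasure p) = ∫⁻ x in Ioi 0, f x * ENNReal.ofReal (x ^ (p - 1)) := by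
  rw [rpowMeasure, lintegral_withDensity_eq_lintegral_mul _ (by fun_prop) hf]
  exact lintegral_congr fun x => mul_comm _ _

theorem laplace_rpowMeasure {p s : ℝ} (hp : 0 < p) (hs : 0 < s) :
    ∫⁻ x, ENNReal.ofReal (Real.exp (-(s * x))) ∂(rpowMeasure p) =
      ENNReal.ofReal ((1 / s) ^ p * Real.Gamma p) := by
  rw [lintegral_rpowMeasure _ (by fun_prop), ← Real.integral_rpow_mul_exp_neg_mul_Ioi hp hs,
    ofReal_integral_eq_lintegral_ofReal]
  · refine setLIntegral_congr_fun measurableSet_Ioi fun x hx => ?_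
    rw [← ENNReal.ofReal_mul (Real.exp_pos _).le, mul_comm]
  · refine Integrable.of_integral_ne_zero ?_
    rw [Real.integral_rpow_mul_exp_neg_mul_Ioi hp hs]
    have := Real.Gamma_pos_of_pos hp
    positivity
  · filter_upwards [ae_restrict_mem measurableSet_Ioi] with x hx
    have : 0 < x := hx
    positivity

theorem rpowMeasure_Iic {p t : ℝ} (hp : 0 < p) (ht : 0 ≤ t) :
    rpowMeasure p (Iic t) = ENNReal.ofReal (t ^ p / p) := by
  rw [rpowMeasure, withDensity_apply _ measurableSet_Iic, Measure.restrict_restrict measurableSet_Iic,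
    Set.inter_comm, Ioi_inter_Iic, ← ofReal_integral_eq_lintegral_ofReal,
    ← intervalIntegral.integral_of_le ht, integral_rpow (Or.inl (by linarith))]
  · rw [sub_add_cancel, Real.zero_rpow hp.ne', sub_zero]
  · have := intervalIntegral.intervalIntegrable_rpow' (a := 0) (b := t) (r := p - 1) (by linarith)
    exact (intervalIntegrable_iff_integrableOn_Ioc_of_le ht).1 this
  · filter_upwards [ae_restrict_mem measurableSet_Ioc] with x hx
    have : 0 < x := hx.1
    positivity

/-! ### Generating functions of the Poisson and generalized counting laws -/

section Poisson

theorem hasSum_poisson_pgf (r : ℝ≥0) (z : ℝ) :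
    HasSum (fun n : ℕ => Real.exp (-r) * r ^ n / n.factorial * z ^ n)
      (Real.exp (r * (z - 1))) := by
  have h := (NormedSpace.expSeries_div_hasSum_exp ((r : ℝ) * z)).mul_left (Real.exp (-r))
  rw [← Real.exp_eq_exp_ℝ, ← Real.exp_add] at h
  have h1 : (fun n : ℕ => Real.exp (-r) * r ^ n / n.factorial * z ^ n) =
      fun n : ℕ => Real.exp (-r) * ((r * z) ^ n / n.factorial) := by
    funext n
    rw [mul_pow]
    ring
  have h2 : (r : ℝ) * (z - 1) = -r + r * z := by ring
  rw [h1, h2]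
  exact h

theorem integrable_pow_poissonMeasure (r : ℝ≥0) (z : ℝ) :
    Integrable (fun n : ℕ => z ^ n) (poissonMeasure r) := by
  rw [integrable_poissonMeasure_iff]
  simp_rw [norm_pow]
  exact (hasSum_poisson_pgf r ‖z‖).summable

theorem integral_pow_poissonMeasure (r : ℝ≥0) (z : ℝ) :
    ∫ n, z ^ n ∂(poissonMeasure r) = Real.exp (r * (z - 1)) := by
  rw [integral_poissonMeasure]
  exact (hasSum_poisson_pgf r z).tsum_eq

theorem measurable_sum_succ_mul (k : ℕ) :
    Measurable fun x : Fin k → ℕ => ∑ i : Fin k, ((i : ℕ) + 1) * x i :=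
  Finset.measurable_sum _ fun i _ => (measurable_pi_apply i).const_mul _

variable {k : ℕ} (lam : Fin k → ℝ≥0) (t : ℝ≥0)

theorem pow_sum_eq_prod (h : ℝ) (x : Fin k → ℕ) :
    h ^ (∑ i : Fin k, ((i : ℕ) + 1) * x i) = ∏ i : Fin k, (h ^ ((i : ℕ) + 1)) ^ x i := by
  rw [← Finset.prod_pow_eq_pow_sum]
  exact Finset.prod_congr rfl fun i _ => pow_mul _ _ _

theorem integrable_pow_gcpLaw (h : ℝ) : Integrable (fun n : ℕ => h ^ n) (gcpLaw lam t) := by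
  rw [gcpLaw, integrable_map_measure .of_discrete (measurable_sum_succ_mul k).aemeasurable]
  simp only [Function.comp_def, pow_sum_eq_prod]
  exact Integrable.fintype_prod fun i => integrable_pow_poissonMeasure _ (h ^ ((i : ℕ) + 1))

theorem integral_pow_gcpLaw (h : ℝ) :
    ∫ n, h ^ n ∂(gcpLaw lam t) =
      Real.exp ((∑ i : Fin k, (lam i : ℝ) * (h ^ ((i : ℕ) + 1) - 1)) * t) := by
  rw [gcpLaw, integral_map (measurable_sum_succ_mul k).aemeasurable .of_discrete]
  simp only [pow_sum_eq_prod]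
  rw [integral_fintype_prod_eq_prod (fun (i : Fin k) (n : ℕ) => (h ^ ((i : ℕ) + 1)) ^ n)]
  simp only [integral_pow_poissonMeasure]
  rw [← Real.exp_sum, Finset.sum_mul]
  refine congrArg _ (Finset.sum_congr rfl fun i _ => ?_)
  push_cast
  ring

end Poisson

/-! ### Maximal inequality for the claim walk -/

section RandomWalk

variable {Ω : Type*} [MeasurableSpace Ω] {P : Measure Ω}

/-- The partial sums of `y`, frozen after the first passage above `u`. -/
noncomputable def stoppedSum (u : ℝ) (y : ℕ → ℝ) : ℕ → ℝ
  | 0 => 0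
  | m + 1 => if u < stoppedSum u y m then stoppedSum u y m else stoppedSum u y m + y m

theorem stoppedSum_eq_or (u : ℝ) (y : ℕ → ℝ) (m : ℕ) :
    u < stoppedSum u y m ∨ stoppedSum u y m = ∑ j ∈ Finset.range m, y j := by
  induction m with
  | zero => simp [stoppedSum]
  | succ m ih =>
    by_cases h : u < stoppedSum u y m
    · left; simp [stoppedSum, h]
    · right
      rw [Finset.sum_range_succ, ← ih.resolve_left h]
      simp [stoppedSum, h]

theorem lt_stoppedSum_mono {u : ℝ} {y : ℕ → ℝ} {n m : ℕ} (hnm : n ≤ m)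
    (h : u < stoppedSum u y n) : u < stoppedSum u y m := by
  induction m, hnm using Nat.le_induction with
  | base => exact h
  | succ m _ ih => simp [stoppedSum, ih]

/-- Freezing replaces an event about the running maximum by one about a single time. -/
theorem lt_stoppedSum_of_lt_sum {u : ℝ} {y : ℕ → ℝ} {n m : ℕ} (hnm : n ≤ m)
    (h : u < ∑ j ∈ Finset.range n, y j) : u < stoppedSum u y m := by
  refine lt_stoppedSum_mono hnm ?_
  rcases stoppedSum_eq_or u y n with h' | h'
  · exact h'
  · rwa [h']

theorem measurable_stoppedSum (u : ℝ) (m : ℕ) : Measurable fun y : ℕ → ℝ => stoppedSum u y m := by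
  induction m with
  | zero => exact measurable_const
  | succ m ih =>
    exact Measurable.ite (measurableSet_lt measurable_const ih) ih (ih.add (measurable_pi_apply m))

theorem stoppedSum_congr (u : ℝ) {y z : ℕ → ℝ} {m : ℕ} (h : ∀ j < m, y j = z j) :
    stoppedSum u y m = stoppedSum u z m := by
  induction m with
  | zero => rfl
  | succ m ih =>
    rw [stoppedSum, stoppedSum, ih fun j hj => h j (hj.trans m.lt_succ_self), h m m.lt_succ_self]

theorem indepFun_stoppedSum {Y : ℕ → Ω → ℝ} (hYmeas : ∀ j, Measurable (Y j))
    (hYindep : iIndepFun Y P) (u : ℝ) (m : ℕ) :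
    IndepFun (fun ω => stoppedSum u (fun j => Y j ω) m) (Y m) P := by
  have hd : Disjoint (Finset.range m) {m} := by simp
  have h := hYindep.indepFun_finset _ _ hd hYmeas
  -- The padding by `0` is harmless: the stopped sum at `m` reads only the coordinates below `m`.
  let ext : (Finset.range m → ℝ) → ℕ → ℝ := fun x j => if hj : j ∈ Finset.range m then x ⟨j, hj⟩ else 0
  have hext : Measurable ext := by
    refine measurable_pi_lambda _ fun j => ?_
    by_cases hj : j ∈ Finset.range m
    · simp only [ext, dif_pos hj]
      exact measurable_pi_apply (⟨j, hj⟩ : Finset.range m)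
    · simp only [ext, dif_neg hj]
      exact measurable_const
  have h2 := h.comp ((measurable_stoppedSum u m).comp hext)
    (measurable_pi_apply (⟨m, Finset.mem_singleton_self m⟩ : ({m} : Finset ℕ)))
  have h3 : (fun ω => stoppedSum u (fun j => Y j ω) m) =
      ((fun y => stoppedSum u y m) ∘ ext) ∘ fun ω (i : Finset.range m) => Y i ω := by
    funext ω
    refine stoppedSum_congr u fun j hj => ?_
    simp [ext, hj]
  rw [h3]
  exact h2

/-- Each step multiplies the frozen part (`g`) by `1 ≤ H` and, by independence, the running part
(`f`) by exactly `H`. -/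
theorem lintegral_exp_stoppedSum_le [IsProbabilityMeasure P] {Y : ℕ → Ω → ℝ}
    (hYmeas : ∀ j, Measurable (Y j))
    (hYindep : iIndepFun Y P) {ξ : ℝ} {H : ℝ≥0∞} (hH1 : 1 ≤ H)
    (hH : ∀ j, ∫⁻ ω, ENNReal.ofReal (Real.exp (ξ * Y j ω)) ∂P = H) (u : ℝ) (m : ℕ) :
    ∫⁻ ω, ENNReal.ofReal (Real.exp (ξ * stoppedSum u (fun j => Y j ω) m)) ∂P ≤ H ^ m := by
  induction m with
  | zero => simp [stoppedSum]
  | succ m ih =>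
    set T : Ω → ℝ := fun ω => stoppedSum u (fun j => Y j ω) m with hT
    have hTm : Measurable T := (measurable_stoppedSum u m).comp (measurable_pi_lambda _ hYmeas)
    let f : ℝ → ℝ≥0∞ := fun x => if u < x then 0 else ENNReal.ofReal (Real.exp (ξ * x))
    let g : ℝ → ℝ≥0∞ := fun x => if u < x then ENNReal.ofReal (Real.exp (ξ * x)) else 0
    let e : ℝ → ℝ≥0∞ := fun x => ENNReal.ofReal (Real.exp (ξ * x))
    have he : Measurable e := by fun_prop
    have hf : Measurable f := Measurable.ite measurableSet_Ioi measurable_const he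
    have hg : Measurable g := Measurable.ite measurableSet_Ioi he measurable_const
    have hind : IndepFun (f ∘ T) (e ∘ Y m) P := (indepFun_stoppedSum hYmeas hYindep u m).comp hf he
    have hgT : Measurable fun ω => g (T ω) := hg.comp hTm
    have hmul := lintegral_mul_eq_lintegral_mul_lintegral_of_indepFun (hf.comp hTm)
      (he.comp (hYmeas m)) hind
    have hsplit : ∀ ω, ENNReal.ofReal (Real.exp (ξ * stoppedSum u (fun j => Y j ω) (m + 1))) =
        g (T ω) + (f ∘ T * e ∘ Y m) ω := by
      intro ω
      by_cases h : u < T ω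
      · have h' := h
        rw [hT] at h'
        simp only [Pi.mul_apply, Function.comp, f, g, if_pos h, stoppedSum, if_pos h']
        simp [hT]
      · have h' := h
        rw [hT] at h'
        simp only [Pi.mul_apply, Function.comp, f, g, e, if_neg h, stoppedSum, if_neg h', zero_add]
        rw [← ENNReal.ofReal_mul (Real.exp_pos _).le, ← Real.exp_add, mul_add]
    calc ∫⁻ ω, ENNReal.ofReal (Real.exp (ξ * stoppedSum u (fun j => Y j ω) (m + 1))) ∂P
        = ∫⁻ ω, g (T ω) ∂P + (∫⁻ ω, f (T ω) ∂P) * H := by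
          simp_rw [hsplit]
          rw [lintegral_add_left hgT, hmul]
          simp only [Function.comp, e, hH]
      _ ≤ (∫⁻ ω, g (T ω) ∂P) * H + (∫⁻ ω, f (T ω) ∂P) * H := by
          gcongr
          exact le_mul_of_one_le_right' hH1
      _ = (∫⁻ ω, e (T ω) ∂P) * H := by
          rw [← add_mul, ← lintegral_add_left hgT]
          congr 2
          funext ω
          by_cases h : u < T ω <;> simp [f, g, e, h]
      _ ≤ H ^ (m + 1) := by
          rw [pow_succ]
          gcongr

/-- A maximal inequality for the exponential of a random walk with `E[exp (ξ Y)] ≥ 1`. -/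
theorem measure_lt_stoppedSum_le [IsProbabilityMeasure P] {Y : ℕ → Ω → ℝ}
    (hYmeas : ∀ j, Measurable (Y j))
    (hYindep : iIndepFun Y P) {ξ : ℝ} (hξ : 0 < ξ) {H : ℝ≥0∞} (hH1 : 1 ≤ H)
    (hH : ∀ j, ∫⁻ ω, ENNReal.ofReal (Real.exp (ξ * Y j ω)) ∂P = H) (u : ℝ) (m : ℕ) :
    P {ω | u < stoppedSum u (fun j => Y j ω) m} ≤ ENNReal.ofReal (Real.exp (-u * ξ)) * H ^ m := by
  have hTm : Measurable fun ω => stoppedSum u (fun j => Y j ω) m :=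
    (measurable_stoppedSum u m).comp (measurable_pi_lambda _ hYmeas)
  have h1 := mul_meas_ge_le_lintegral (μ := P)
    (f := fun ω => ENNReal.ofReal (Real.exp (ξ * stoppedSum u (fun j => Y j ω) m)))
    (by fun_prop) (ENNReal.ofReal (Real.exp (u * ξ)))
  calc P {ω | u < stoppedSum u (fun j => Y j ω) m}
      = ENNReal.ofReal (Real.exp (-u * ξ)) * (ENNReal.ofReal (Real.exp (u * ξ)) *
          P {ω | u < stoppedSum u (fun j => Y j ω) m}) := by
        rw [← mul_assoc, ← ENNReal.ofReal_mul (Real.exp_pos _).le, ← Real.exp_add]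
        simp
    _ ≤ ENNReal.ofReal (Real.exp (-u * ξ)) * H ^ m := by
        gcongr
        refine le_trans ?_ (h1.trans (lintegral_exp_stoppedSum_le hYmeas hYindep hH1 hH u m))
        gcongr with ω
        intro h
        refine ENNReal.ofReal_le_ofReal (Real.exp_le_exp.2 ?_)
        rw [mul_comm]
        exact mul_le_mul_of_nonneg_left h.le hξ.le

end RandomWalk

/-! ### Moments of the inverse stable subordinator -/

section InverseSubordinator

variable {Ω : Type*} [MeasurableSpace Ω] {P : Measure Ω} {β : ℝ} {S : ℝ≥0 → Ω → ℝ}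

theorem IsStableSubordinator.lintegral_exp (hS : IsStableSubordinator β S P) (r : ℝ≥0) {u : ℝ}
    (hu : 0 < u) : ∫⁻ ω, ENNReal.ofReal (Real.exp (-(u * S r ω))) ∂P =
      ENNReal.ofReal (Real.exp (-(u ^ β * r))) := by
  have h := hS.laplace r u hu
  -- A non-integrable function has Bochner integral `0`, so the positive Laplace transform forces
  -- integrability.
  have hint : Integrable (fun ω => Real.exp (-u * S r ω)) P :=
    Integrable.of_integral_ne_zero (by rw [h]; positivity)
  have h' := ofReal_integral_eq_lintegral_ofReal hint
    (Filter.Eventually.of_forall fun ω => (Real.exp_pos _).le)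
  rw [h] at h'
  simp only [neg_mul] at h'
  rw [← h', mul_comm]

/-- Monotone paths make `r ↦ P(S(r) ≤ x)` antitone, hence measurable; the laws can then be mixed
over `r`. -/
theorem IsStableSubordinator.measurable_law [IsProbabilityMeasure P]
    (hS : IsStableSubordinator β S P) :
    Measurable fun r : ℝ => P.map (S r.toNNReal) := by
  have : ∀ r : ℝ, IsProbabilityMeasure (P.map (S r.toNNReal)) := fun r =>
    Measure.isProbabilityMeasure_map (hS.measurable _).aemeasurable
  refine Measurable.measure_of_isPiSystem_of_isProbabilityMeasure (borel_eq_generateFrom_Iic ℝ)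
    isPiSystem_Iic ?_
  rintro _ ⟨x, rfl⟩
  refine Antitone.measurable fun r s hrs => ?_
  simp only [Measure.map_apply (hS.measurable _) measurableSet_Iic]
  refine measure_mono_ae ?_
  filter_upwards [hS.monotone] with ω hω h
  exact (hω (Real.toNNReal_le_toNNReal hrs)).trans h

/-- Both sides have Laplace transform `∫ r^{p-1} e^{-r s^β} dr = Γ(p) s^{-pβ}`. -/
theorem IsStableSubordinator.bind_rpowMeasure [IsProbabilityMeasure P] (hβ : 0 < β)
    (hS : IsStableSubordinator β S P) {p : ℝ} (hp : 0 < p) :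
    (rpowMeasure p).bind (fun r : ℝ => P.map (S r.toNNReal)) =
      ENNReal.ofReal (Real.Gamma p / Real.Gamma (p * β)) • rpowMeasure (p * β) := by
  have hpβ : 0 < p * β := mul_pos hp hβ
  have hG := Real.Gamma_pos_of_pos hp
  have hGβ := Real.Gamma_pos_of_pos hpβ
  have hright : ∀ s : ℝ, 0 < s → ∫⁻ x, ENNReal.ofReal (Real.exp (-(s * x)))
      ∂(ENNReal.ofReal (Real.Gamma p / Real.Gamma (p * β)) • rpowMeasure (p * β)) =
        ENNReal.ofReal ((1 / s ^ β) ^ p * Real.Gamma p) := by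
    intro s hs
    rw [lintegral_smul_measure, laplace_rpowMeasure hpβ hs, smul_eq_mul,
      ← ENNReal.ofReal_mul (by positivity)]
    congr 1
    rw [Real.div_rpow zero_le_one hs.le, Real.div_rpow zero_le_one (by positivity),
      ← Real.rpow_mul hs.le, mul_comm β p, Real.one_rpow, Real.one_rpow]
    field_simp
  refine measure_ext_of_laplace (fun s hs => ?_) (fun s hs => ?_)
  · rw [hright s hs, Measure.lintegral_bind hS.measurable_law.aemeasurable (by fun_prop),
      ← laplace_rpowMeasure hp (Real.rpow_pos_of_pos hs β),
      lintegral_rpowMeasure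
        (f := fun r => ∫⁻ x, ENNReal.ofReal (Real.exp (-(s * x))) ∂P.map (S r.toNNReal)) _
        ((Measure.measurable_lintegral (by fun_prop)).comp hS.measurable_law),
      lintegral_rpowMeasure _ (by fun_prop)]
    refine setLIntegral_congr_fun measurableSet_Ioi fun r hr => ?_
    rw [lintegral_map (by fun_prop) (hS.measurable _), hS.lintegral_exp _ hs,
      Real.coe_toNNReal _ (le_of_lt hr)]
  · rw [hright s hs]
    exact ENNReal.ofReal_ne_top

theorem IsStableSubordinator.lintegral_measure_le [IsProbabilityMeasure P] (hβ : 0 < β)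
    (hS : IsStableSubordinator β S P) {p t : ℝ} (hp : 0 < p) (ht : 0 ≤ t) :
    ∫⁻ r in Ioi 0, P {ω | S (Real.toNNReal r) ω ≤ t} * ENNReal.ofReal (r ^ (p - 1)) =
      ENNReal.ofReal (Real.Gamma p * t ^ (p * β) / Real.Gamma (p * β + 1)) := by
  have hpβ : 0 < p * β := mul_pos hp hβ
  have hG := Real.Gamma_pos_of_pos hp
  have hGβ := Real.Gamma_pos_of_pos hpβ
  have h := congrArg (fun m : Measure ℝ => m (Iic t)) (hS.bind_rpowMeasure hβ hp)
  simp only [Measure.smul_apply, rpowMeasure_Iic hpβ ht, smul_eq_mul] at h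
  rw [← ENNReal.ofReal_mul (by positivity),
    Measure.bind_apply measurableSet_Iic hS.measurable_law.aemeasurable,
    lintegral_rpowMeasure (f := fun r => P.map (S r.toNNReal) (Iic t)) _
      ((Measure.measurable_coe measurableSet_Iic).comp hS.measurable_law)] at h
  simp only [Measure.map_apply (hS.measurable _) measurableSet_Iic] at h
  refine Eq.trans h (congrArg _ ?_)
  rw [Real.Gamma_add_one hpβ.ne']
  field_simp

/-- Chernoff's bound with Laplace parameter `1`. -/
theorem IsStableSubordinator.measure_le_le [IsProbabilityMeasure P]
    (hS : IsStableSubordinator β S P) (r : ℝ≥0) (t : ℝ) :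
    P {ω | S r ω ≤ t} ≤ ENNReal.ofReal (Real.exp t * Real.exp (-r)) := by
  have hm := hS.measurable r
  have h1 := mul_meas_ge_le_lintegral (μ := P)
    (f := fun ω => ENNReal.ofReal (Real.exp (-(1 * S r ω))))
    (by fun_prop) (ENNReal.ofReal (Real.exp (-t)))
  rw [hS.lintegral_exp r one_pos] at h1
  calc P {ω | S r ω ≤ t}
      = ENNReal.ofReal (Real.exp t) * (ENNReal.ofReal (Real.exp (-t)) * P {ω | S r ω ≤ t}) := by
        rw [← mul_assoc, ← ENNReal.ofReal_mul (Real.exp_pos _).le, ← Real.exp_add]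
        simp
    _ ≤ ENNReal.ofReal (Real.exp t) * ENNReal.ofReal (Real.exp (-r)) := by
        gcongr
        refine le_trans ?_ (h1.trans (by simp))
        gcongr with ω
        intro h
        refine ENNReal.ofReal_le_ofReal (Real.exp_le_exp.2 ?_)
        linarith
    _ = _ := (ENNReal.ofReal_mul (Real.exp_pos _).le).symm

/-- This excludes the empty set in the first passage time, whose infimum in `ℝ≥0` would be the
default value `0`. -/
theorem IsStableSubordinator.ae_exists_lt [IsProbabilityMeasure P]
    (hS : IsStableSubordinator β S P) (t : ℝ) : ∀ᵐ ω ∂P, ∃ r, t < S r ω := by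
  have hlim : Filter.Tendsto (fun n : ℕ => ENNReal.ofReal (Real.exp t * Real.exp (-((n : ℝ≥0) : ℝ))))
      Filter.atTop (𝓝 0) := by
    rw [← ENNReal.ofReal_zero, ← mul_zero (Real.exp t)]
    refine ENNReal.tendsto_ofReal (Filter.Tendsto.const_mul _ ?_)
    exact Real.tendsto_exp_neg_atTop_nhds_zero.comp tendsto_natCast_atTop_atTop
  refine le_antisymm (ge_of_tendsto' hlim fun n => le_trans (measure_mono ?_)
    (hS.measure_le_le n t)) bot_le
  intro ω hω
  simp only [mem_compl_iff, mem_ofPred_eq, not_exists, not_lt] at hω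
  exact hω _

/-- The first passage time of a path above the level `t`, read off from the rational times. -/
noncomputable def rationalPassage (t : ℝ) (x : ℝ≥0 → ℝ) : ℝ≥0 :=
  (⨅ q : ℚ, if t < x (Real.toNNReal q) then ((Real.toNNReal q : ℝ≥0) : ℝ≥0∞) else ⊤).toNNReal

theorem measurable_rationalPassage (t : ℝ) : Measurable (rationalPassage t) := by
  refine ENNReal.measurable_toNNReal.comp (Measurable.iInf fun q => ?_)
  exact Measurable.ite (measurableSet_lt measurable_const (measurable_pi_apply _))
    measurable_const measurable_const

theorem rationalPassage_eq {t : ℝ} {x : ℝ≥0 → ℝ} (hx : Monotone x) (hne : ∃ r, t < x r) :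
    rationalPassage t x = sInf {r : ℝ≥0 | t < x r} := by
  rw [rationalPassage, ← ENNReal.toNNReal_coe (sInf {r : ℝ≥0 | t < x r}), ENNReal.coe_sInf (s := {r : ℝ≥0 | t < x r}) hne]
  congr 1
  refine le_antisymm ?_ ?_
  · refine le_iInf₂ fun r hr => le_of_forall_gt fun b hb => ?_
    obtain ⟨q, -, hq1, hq2⟩ := ENNReal.lt_iff_exists_rat_btwn.1 hb
    refine lt_of_le_of_lt (iInf_le _ q) ?_
    have : r < Real.toNNReal q := by exact_mod_cast hq1
    rw [if_pos (lt_of_lt_of_le hr (hx this.le))]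
    exact hq2
  · refine le_iInf fun q => ?_
    split_ifs with h
    · exact iInf₂_le (f := fun (a : ℝ≥0) (_ : a ∈ {r : ℝ≥0 | t < x r}) => (a : ℝ≥0∞)) _ h
    · exact le_top

/-- The infimum over rational times is a measurable function of the whole path, so measurability of
the passage time and its independence from `N` follow by composition. -/
theorem IsStableSubordinator.inverse_ae_eq [IsProbabilityMeasure P]
    (hS : IsStableSubordinator β S P) (t : ℝ≥0) :
    ∀ᵐ ω ∂P, inverseSubordinator S t ω = rationalPassage t fun r => S r ω := by
  filter_upwards [hS.monotone, hS.ae_exists_lt t] with ω h1 h2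
  exact (rationalPassage_eq h1 h2).symm

theorem IsStableSubordinator.aemeasurable_inverse [IsProbabilityMeasure P]
    (hS : IsStableSubordinator β S P) (t : ℝ≥0) : AEMeasurable (inverseSubordinator S t) P :=
  ⟨_, (measurable_rationalPassage t).comp (measurable_pi_lambda _ hS.measurable),
    hS.inverse_ae_eq t⟩

/-- Layer-cake formula: if `W(t) > r` then `S(r) ≤ t`, and the integral of `P(S(r) ≤ t)` against
`r^{p-1} dr` is known. Only this inclusion is needed for an upper bound. -/
theorem IsStableSubordinator.lintegral_inverse_rpow_le [IsProbabilityMeasure P] (hβ : 0 < β)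
    (hS : IsStableSubordinator β S P) (t : ℝ≥0) {p : ℝ} (hp : 0 < p) :
    ∫⁻ ω, ENNReal.ofReal ((inverseSubordinator S t ω : ℝ) ^ p) ∂P ≤
      ENNReal.ofReal (Real.Gamma (p + 1) * (t : ℝ) ^ (p * β) / Real.Gamma (p * β + 1)) := by
  have hm : AEMeasurable (fun ω => (inverseSubordinator S t ω : ℝ)) P :=
    (hS.aemeasurable_inverse t).coe_nnreal_real
  rw [lintegral_rpow_eq_lintegral_meas_lt_mul P
    (Filter.Eventually.of_forall fun ω => NNReal.coe_nonneg _) hm hp, Real.Gamma_add_one hp.ne',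
    mul_assoc, mul_div_assoc, ENNReal.ofReal_mul hp.le,
    ← hS.lintegral_measure_le hβ hp t.coe_nonneg]
  gcongr ENNReal.ofReal p * ?_
  refine setLIntegral_mono_ae' measurableSet_Ioi (Filter.Eventually.of_forall fun r hr => ?_)
  gcongr with ω
  intro h
  by_contra! hlt
  have : inverseSubordinator S t ω ≤ r.toNNReal := csInf_le (OrderBot.bddBelow _) hlt
  have h2 : (inverseSubordinator S t ω : ℝ) ≤ r := by
    rw [← Real.coe_toNNReal r (le_of_lt hr)]
    exact_mod_cast this
  exact absurd h (not_lt.2 h2)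

/-- The exponential moment of the inverse subordinator is a Mittag-Leffler function, which is
bounded by a geometric series. -/
theorem IsStableSubordinator.lintegral_exp_inverse_le [IsProbabilityMeasure P] (hβ : 0 < β)
    (hS : IsStableSubordinator β S P) {t : ℝ≥0} {c : ℝ} (hc : 0 ≤ c)
    (hct : c * (t : ℝ) ^ β < 1) :
    ∫⁻ ω, ENNReal.ofReal (Real.exp (c * inverseSubordinator S t ω)) ∂P ≤
      ENNReal.ofReal ((1 - c * (t : ℝ) ^ β)⁻¹ * gammaMin⁻¹) := by
  set x := c * (t : ℝ) ^ β with hx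
  have hx0 : 0 ≤ x := by positivity
  have hg : 0 < gammaMin := by linarith [half_lt_gammaMin]
  have hm : AEMeasurable (fun ω => (inverseSubordinator S t ω : ℝ)) P :=
    (hS.aemeasurable_inverse t).coe_nnreal_real
  have hexp : ∀ ω, ENNReal.ofReal (Real.exp (c * inverseSubordinator S t ω)) =
      ∑' n : ℕ, ENNReal.ofReal (c ^ n / n.factorial) *
        ENNReal.ofReal ((inverseSubordinator S t ω : ℝ) ^ n) := by
    intro ω
    have h := NormedSpace.expSeries_div_hasSum_exp (c * inverseSubordinator S t ω)
    rw [← Real.exp_eq_exp_ℝ] at h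
    rw [← h.tsum_eq, ENNReal.ofReal_tsum_of_nonneg (fun n => by positivity) h.summable]
    refine tsum_congr fun n => ?_
    rw [← ENNReal.ofReal_mul (by positivity), mul_pow]
    congr 1
    ring
  have hterm : ∀ n : ℕ, ∫⁻ ω, ENNReal.ofReal (c ^ n / n.factorial) *
      ENNReal.ofReal ((inverseSubordinator S t ω : ℝ) ^ n) ∂P ≤
        ENNReal.ofReal (x ^ n * gammaMin⁻¹) := by
    intro n
    rw [lintegral_const_mul'' _ (by fun_prop)]
    have hmom : ∫⁻ ω, ENNReal.ofReal ((inverseSubordinator S t ω : ℝ) ^ n) ∂P ≤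
        ENNReal.ofReal (n.factorial * (t : ℝ) ^ (n * β) / Real.Gamma (n * β + 1)) := by
      -- The moment bound requires a positive exponent, so the constant term is treated apart.
      rcases Nat.eq_zero_or_pos n with rfl | hn
      · simp
      · have h := hS.lintegral_inverse_rpow_le hβ t (p := n) (by exact_mod_cast hn)
        simpa only [Real.rpow_natCast, Real.Gamma_nat_eq_factorial] using h
    refine (mul_le_mul_right hmom _).trans ?_
    rw [← ENNReal.ofReal_mul (by positivity)]
    refine ENNReal.ofReal_le_ofReal ?_
    have hxn : x ^ n = c ^ n * (t : ℝ) ^ (n * β) := by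
      rw [hx, mul_pow, mul_comm (n : ℝ) β, Real.rpow_mul t.coe_nonneg, Real.rpow_natCast]
    have hpos : (0 : ℝ) < n * β + 1 := by positivity
    have hfac : (n.factorial : ℝ) ≠ 0 := by positivity
    -- The factorials cancel, leaving the Mittag-Leffler coefficient `1 / Γ(nβ+1)`.
    calc c ^ n / n.factorial * (n.factorial * (t : ℝ) ^ (n * β) / Real.Gamma (n * β + 1))
        = x ^ n * (Real.Gamma (n * β + 1))⁻¹ := by rw [hxn]; field_simp
      _ ≤ x ^ n * gammaMin⁻¹ := by
        gcongr
        exact gammaMin_le_Gamma hpos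
  simp_rw [hexp]
  rw [lintegral_tsum fun n => by fun_prop]
  refine (ENNReal.tsum_le_tsum hterm).trans ?_
  have hsum := (hasSum_geometric_of_lt_one hx0 hct).mul_right gammaMin⁻¹
  rw [← ENNReal.ofReal_tsum_of_nonneg (fun n => by positivity) hsum.summable, hsum.tsum_eq]

end InverseSubordinator

/-! ### The counting process at an independent random time -/

section GeneralizedCounting

variable {Ω : Type*} [MeasurableSpace Ω] {P : Measure Ω} {k : ℕ} {lam : Fin k → ℝ≥0}
  {N : ℝ≥0 → Ω → ℕ}

/-- The least multiple of `d` that is strictly above `x`. -/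
noncomputable def gridAbove (d x : ℝ≥0) : ℝ≥0 := ((⌊x / d⌋₊ + 1 : ℕ) : ℝ≥0) * d

theorem lt_gridAbove {d : ℝ≥0} (hd : 0 < d) (x : ℝ≥0) : x < gridAbove d x := by
  have h := Nat.lt_floor_add_one (x / d)
  rw [div_lt_iff₀ hd] at h
  simpa [gridAbove] using h

theorem gridAbove_le {d : ℝ≥0} (hd : 0 < d) (x : ℝ≥0) : gridAbove d x ≤ x + d := by
  have h := Nat.floor_le (a := x / d) zero_le
  rw [le_div_iff₀ hd] at h
  rw [gridAbove]
  push_cast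
  rw [add_mul, one_mul]
  gcongr

theorem tendsto_gridAbove (x : ℝ≥0) {d : ℕ → ℝ≥0} (hd : ∀ n, 0 < d n)
    (hlim : Filter.Tendsto d Filter.atTop (𝓝 0)) :
    Filter.Tendsto (fun n => gridAbove (d n) x) Filter.atTop (𝓝[≥] x) := by
  refine tendsto_nhdsWithin_iff.2 ⟨?_, Filter.Eventually.of_forall fun n => (lt_gridAbove (hd n) x).le⟩
  refine tendsto_of_tendsto_of_tendsto_of_le_of_le tendsto_const_nhds
    (h := fun n => x + d n) ?_ (fun n => (lt_gridAbove (hd n) x).le) (fun n => gridAbove_le (hd n) x)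
  simpa using hlim.const_add x

theorem IsGCP.lintegral_pow (hN : IsGCP lam N P) {h : ℝ} (hh : 0 ≤ h) (q : ℝ≥0) :
    ∫⁻ ω, ENNReal.ofReal (h ^ N q ω) ∂P =
      ENNReal.ofReal (Real.exp ((∑ i : Fin k, (lam i : ℝ) * (h ^ ((i : ℕ) + 1) - 1)) * q)) := by
  have hae : (fun ω => ENNReal.ofReal (h ^ N q ω)) =ᵐ[P]
      fun ω => ENNReal.ofReal (h ^ (N (0 + q) ω - N 0 ω)) := by
    filter_upwards [hN.zero] with ω hω
    rw [hω, zero_add, Nat.sub_zero]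
  have hm : Measurable fun ω => N (0 + q) ω - N 0 ω := (hN.measurable _).sub (hN.measurable _)
  have hmap := lintegral_map (μ := P) (f := fun n : ℕ => ENNReal.ofReal (h ^ n))
    .of_discrete hm
  rw [lintegral_congr_ae hae, ← hmap, hN.law, ← integral_pow_gcpLaw,
    ofReal_integral_eq_lintegral_ofReal (integrable_pow_gcpLaw lam q h)
      (Filter.Eventually.of_forall fun n => pow_nonneg hh n)]

theorem measurable_comp_gridAbove (hN : ∀ t, Measurable (N t)) {T : Ω → ℝ≥0} (hT : Measurable T)
    (d : ℝ≥0) : Measurable fun ω => N (gridAbove d (T ω)) ω := by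
  have h1 : Measurable fun p : ℕ × Ω => N (((p.1 + 1 : ℕ) : ℝ≥0) * d) p.2 :=
    measurable_from_prod_countable_right fun n => hN (((n + 1 : ℕ) : ℝ≥0) * d)
  exact h1.comp ((Nat.measurable_floor.comp (hT.div_const d)).prodMk measurable_id)

/-- Grid times decrease the problem to countably many fixed times; right-continuity recovers `N(T)`
as an almost sure limit. -/
theorem IsGCP.aemeasurable_comp (hN : IsGCP lam N P) {T : Ω → ℝ≥0} (hT : Measurable T) :
    AEMeasurable (fun ω => N (T ω) ω) P := by
  obtain ⟨d, -, hd, hlim⟩ := exists_seq_strictAnti_tendsto (0 : ℝ≥0)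
  refine aemeasurable_of_tendsto_metrizable_ae Filter.atTop
    (fun n => (measurable_comp_gridAbove hN.measurable hT (d n)).aemeasurable) ?_
  filter_upwards [hN.rightCont] with ω hω
  exact (hω (T ω)).tendsto.comp (tendsto_gridAbove (T ω) hd hlim)

/-- The rounded time takes countably many values, and independence factors the expectation on each
cell of the grid. -/
theorem IsGCP.lintegral_pow_comp_gridAbove (hN : IsGCP lam N P) {T : Ω → ℝ≥0} (hT : Measurable T)
    (hind : IndepFun (fun ω t => N t ω) T P) {h : ℝ} (hh : 0 ≤ h) (d : ℝ≥0) :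
    ∫⁻ ω, ENNReal.ofReal (h ^ N (gridAbove d (T ω)) ω) ∂P =
      ∫⁻ ω, ENNReal.ofReal (Real.exp
        ((∑ i : Fin k, (lam i : ℝ) * (h ^ ((i : ℕ) + 1) - 1)) * gridAbove d (T ω))) ∂P := by
  set c := ∑ i : Fin k, (lam i : ℝ) * (h ^ ((i : ℕ) + 1) - 1) with hc
  let K : ℝ≥0 → ℕ := fun x => ⌊x / d⌋₊
  have hK : Measurable K := Nat.measurable_floor.comp (measurable_id.div_const d)
  let I : ℕ → ℝ≥0 → ℝ≥0∞ := fun j => (K ⁻¹' {j}).indicator 1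
  have hI : ∀ j, Measurable (I j) := fun j =>
    measurable_one.indicator (hK (measurableSet_singleton j))
  let g : ℕ → ℝ≥0 := fun j => ((j + 1 : ℕ) : ℝ≥0) * d
  have hdecomp : ∀ (F : ℝ≥0 → ℝ≥0∞) (x : ℝ≥0), F (gridAbove d x) = ∑' j, F (g j) * I j x := by
    intro F x
    rw [tsum_eq_single (K x)]
    · simp [I, g, K, gridAbove]
    · intro j hj
      simp [I, hj.symm]
  have hl : ∀ ω, ENNReal.ofReal (h ^ N (gridAbove d (T ω)) ω) =
      ∑' j, ENNReal.ofReal (h ^ N (g j) ω) * I j (T ω) := fun ω =>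
    hdecomp (fun s => ENNReal.ofReal (h ^ N s ω)) (T ω)
  have hr : ∀ ω, ENNReal.ofReal (Real.exp (c * gridAbove d (T ω))) =
      ∑' j, ENNReal.ofReal (Real.exp (c * g j)) * I j (T ω) := fun ω =>
    hdecomp (fun s => ENNReal.ofReal (Real.exp (c * s))) (T ω)
  have hpow : ∀ s, Measurable fun ω => ENNReal.ofReal (h ^ N s ω) := fun s =>
    (Measurable.of_discrete (f := fun n : ℕ => ENNReal.ofReal (h ^ n))).comp (hN.measurable s)
  have hIT : ∀ j, Measurable fun ω => I j (T ω) := fun j => (hI j).comp hT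
  simp_rw [hl, hr]
  rw [lintegral_tsum fun j => ((hpow (g j)).fun_mul (hIT j)).aemeasurable,
    lintegral_tsum fun j => ((hIT j).const_mul _).aemeasurable]
  refine tsum_congr fun j => ?_
  have hij : IndepFun (fun ω => ENNReal.ofReal (h ^ N (g j) ω)) (fun ω => I j (T ω)) P :=
    hind.comp (φ := fun x : ℝ≥0 → ℕ => ENNReal.ofReal (h ^ x (g j)))
      ((Measurable.of_discrete (f := fun n : ℕ => ENNReal.ofReal (h ^ n))).comp
        (measurable_pi_apply (g j))) (hI j)
  have hmul := lintegral_mul_eq_lintegral_mul_lintegral_of_indepFun (hpow (g j))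
    (hIT j) hij
  simp only [Pi.mul_apply] at hmul
  rw [hmul, hN.lintegral_pow hh, lintegral_const_mul _ (hIT j)]

/-- Subordinating a generalized counting process by an independent random time. -/
theorem IsGCP.lintegral_pow_comp_le (hN : IsGCP lam N P) {T : Ω → ℝ≥0} (hT : Measurable T)
    (hind : IndepFun (fun ω t => N t ω) T P) {h : ℝ} (hh : 1 ≤ h) :
    ∫⁻ ω, ENNReal.ofReal (h ^ N (T ω) ω) ∂P ≤
      ∫⁻ ω, ENNReal.ofReal (Real.exp
        ((∑ i : Fin k, (lam i : ℝ) * (h ^ ((i : ℕ) + 1) - 1)) * T ω)) ∂P := by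
  have hh0 : 0 ≤ h := zero_le_one.trans hh
  set c := ∑ i : Fin k, (lam i : ℝ) * (h ^ ((i : ℕ) + 1) - 1) with hc
  have hc0 : 0 ≤ c := Finset.sum_nonneg fun i _ =>
    mul_nonneg (NNReal.coe_nonneg _) (sub_nonneg.2 (one_le_pow₀ hh))
  obtain ⟨d, -, hd, hlim⟩ := exists_seq_strictAnti_tendsto (0 : ℝ≥0)
  -- Since `h ≥ 1` and paths are monotone, rounding the time up only increases the left side, at the
  -- cost of a factor `e^{c d_n} → 1` on the right. No convergence theorem for integrals is needed.
  have hbound : ∀ n, ∫⁻ ω, ENNReal.ofReal (h ^ N (T ω) ω) ∂P ≤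
      ENNReal.ofReal (Real.exp (c * d n)) * ∫⁻ ω, ENNReal.ofReal (Real.exp (c * T ω)) ∂P := by
    intro n
    calc ∫⁻ ω, ENNReal.ofReal (h ^ N (T ω) ω) ∂P
        ≤ ∫⁻ ω, ENNReal.ofReal (h ^ N (gridAbove (d n) (T ω)) ω) ∂P := by
          refine lintegral_mono_ae ?_
          filter_upwards [hN.monotone] with ω hω
          exact ENNReal.ofReal_le_ofReal
            (pow_le_pow_right₀ hh (hω (lt_gridAbove (hd n) (T ω)).le))
      _ = ∫⁻ ω, ENNReal.ofReal (Real.exp (c * gridAbove (d n) (T ω))) ∂P :=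
          hN.lintegral_pow_comp_gridAbove hT hind hh0 (d n)
      _ ≤ ∫⁻ ω, ENNReal.ofReal (Real.exp (c * d n)) * ENNReal.ofReal (Real.exp (c * T ω)) ∂P := by
          refine lintegral_mono fun ω => ?_
          rw [← ENNReal.ofReal_mul (Real.exp_pos _).le, ← Real.exp_add, ← mul_add]
          have h1 : (gridAbove (d n) (T ω) : ℝ) ≤ T ω + d n := by
            exact_mod_cast gridAbove_le (hd n) (T ω)
          refine ENNReal.ofReal_le_ofReal (Real.exp_le_exp.2 (mul_le_mul_of_nonneg_left ?_ hc0))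
          linarith
      _ = _ := lintegral_const_mul _ (by fun_prop)
  have hlim' : Filter.Tendsto (fun n => ENNReal.ofReal (Real.exp (c * d n)) *
      ∫⁻ ω, ENNReal.ofReal (Real.exp (c * T ω)) ∂P) Filter.atTop
        (𝓝 (1 * ∫⁻ ω, ENNReal.ofReal (Real.exp (c * T ω)) ∂P)) := by
    -- The nonzero limit `1` permits multiplication by a possibly infinite integral.
    refine ENNReal.Tendsto.mul_const ?_ (Or.inl one_ne_zero)
    have h0 : Filter.Tendsto (fun n => (d n : ℝ)) Filter.atTop (𝓝 0) :=
      NNReal.tendsto_coe.2 hlim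
    have := ENNReal.tendsto_ofReal ((Real.continuous_exp.tendsto _).comp (h0.const_mul c))
    simpa using this
  rw [one_mul] at hlim'
  exact ge_of_tendsto' hlim' hbound

end GeneralizedCounting

/-! ### Existence and uniqueness of the exponent -/

section RuinExponent

variable {Ω : Type*} [MeasurableSpace Ω] {P : Measure Ω} [IsProbabilityMeasure P] {Z : Ω → ℝ}

theorem exp_mul_le_one_add_exp_mul {a b : ℝ} (ha : 0 ≤ a) (hab : a ≤ b) (z : ℝ) :
    Real.exp (a * z) ≤ 1 + Real.exp (b * z) := by
  rcases le_total z 0 with hz | hz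
  · have : Real.exp (a * z) ≤ 1 := Real.exp_le_one_iff.2 (mul_nonpos_of_nonneg_of_nonpos ha hz)
    linarith [Real.exp_pos (b * z)]
  · have : Real.exp (a * z) ≤ Real.exp (b * z) := Real.exp_le_exp.2 (by gcongr)
    linarith

theorem integrable_exp_mul_of_le_right (hZ : Integrable Z P) {a b : ℝ} (ha : 0 ≤ a) (hab : a ≤ b)
    (hb : Integrable (fun ω => Real.exp (b * Z ω)) P) :
    Integrable (fun ω => Real.exp (a * Z ω)) P := by
  refine ((integrable_const (1 : ℝ)).add hb).mono' ?_ (Filter.Eventually.of_forall fun ω => ?_)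
  · exact Real.continuous_exp.comp_aestronglyMeasurable (hZ.aestronglyMeasurable.const_mul a)
  · rw [Real.norm_of_nonneg (Real.exp_pos _).le]
    exact exp_mul_le_one_add_exp_mul ha hab (Z ω)

theorem continuousOn_mgf_Icc (hZ : Integrable Z P) {b : ℝ}
    (hb : Integrable (fun ω => Real.exp (b * Z ω)) P) : ContinuousOn (mgf Z P) (Icc 0 b) := by
  refine continuousOn_of_dominated (bound := fun ω => 1 + Real.exp (b * Z ω)) ?_ ?_ ?_ ?_
  · exact fun a _ =>
      Real.continuous_exp.comp_aestronglyMeasurable (hZ.aestronglyMeasurable.const_mul a)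
  · intro a ha
    refine Filter.Eventually.of_forall fun ω => ?_
    rw [Real.norm_of_nonneg (Real.exp_pos _).le]
    exact exp_mul_le_one_add_exp_mul ha.1 ha.2 (Z ω)
  · exact (integrable_const (1 : ℝ)).add hb
  · exact Filter.Eventually.of_forall fun ω => by fun_prop

theorem one_lt_mgf (hZ : Integrable Z P) (hmean : 0 < ∫ ω, Z ω ∂P) {a : ℝ} (ha : 0 < a)
    (hint : Integrable (fun ω => Real.exp (a * Z ω)) P) : 1 < mgf Z P a := by
  have h : ∫ ω, (a * Z ω + 1) ∂P ≤ mgf Z P a :=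
    integral_mono ((hZ.const_mul a).add (integrable_const 1)) hint
      fun ω => Real.add_one_le_exp (a * Z ω)
  rw [integral_add (hZ.const_mul a) (integrable_const 1), integral_const_mul] at h
  simp only [integral_const, probReal_univ, smul_eq_mul, mul_one] at h
  have := mul_pos ha hmean
  linarith

/-- Convexity of `exp` between `0` and `bz` gives `H(a) - 1 ≤ (a/b) (H(b) - 1)`, and `H(b) > 1`
makes this strictly less than `H(b) - 1`. -/
theorem mgf_lt_mgf (hZ : Integrable Z P) (hmean : 0 < ∫ ω, Z ω ∂P) {a b : ℝ} (ha : 0 < a)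
    (hab : a < b) (hb : Integrable (fun ω => Real.exp (b * Z ω)) P) : mgf Z P a < mgf Z P b := by
  have hb0 : 0 < b := ha.trans hab
  have hr1 : a / b < 1 := (div_lt_one hb0).2 hab
  have hr0 : 0 < a / b := div_pos ha hb0
  have hone := one_lt_mgf hZ hmean hb0 hb
  have h : mgf Z P a ≤ ∫ ω, (a / b * Real.exp (b * Z ω) + (1 - a / b)) ∂P := by
    refine integral_mono (integrable_exp_mul_of_le_right hZ ha.le hab.le hb)
      ((hb.const_mul _).add (integrable_const _)) fun ω => ?_
    have hc := convexOn_exp.2 (mem_univ (b * Z ω)) (mem_univ 0) hr0.le (sub_nonneg.2 hr1.le)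
      (by ring)
    simp only [smul_eq_mul, mul_zero, add_zero, Real.exp_zero, mul_one] at hc
    rwa [← mul_assoc, div_mul_cancel₀ _ hb0.ne'] at hc
  rw [integral_add (hb.const_mul _) (integrable_const _), integral_const_mul] at h
  simp only [integral_const, probReal_univ, smul_eq_mul, one_mul] at h
  change mgf Z P a ≤ a / b * mgf Z P b + (1 - a / b) at h
  nlinarith

variable {k : ℕ} {lam : Fin k → ℝ≥0}

theorem rateMgfSum_lt (hk : 1 ≤ k) (hlam : ∀ i, 0 < lam i) (hZ : Integrable Z P)
    (hmean : 0 < ∫ ω, Z ω ∂P) {a b : ℝ} (ha : 0 < a) (hab : a < b)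
    (hb : Integrable (fun ω => Real.exp (b * Z ω)) P) :
    rateMgfSum lam Z P a < rateMgfSum lam Z P b := by
  have : Nonempty (Fin k) := ⟨⟨0, hk⟩⟩
  refine Finset.sum_lt_sum_of_nonempty Finset.univ_nonempty fun i _ => ?_
  refine mul_lt_mul_of_pos_left ?_ (NNReal.coe_pos.2 (hlam i))
  exact pow_lt_pow_left₀ (mgf_lt_mgf hZ hmean ha hab hb) mgf_nonneg (Nat.succ_ne_zero _)

theorem sum_lt_ruinLevel {β : ℝ} {t : ℝ≥0} (ht : 0 < t) :
    ∑ i : Fin k, (lam i : ℝ) < ruinLevel lam β t := by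
  have hg := half_lt_gammaMin
  have ht' : (0 : ℝ) < (t : ℝ) ^ β := Real.rpow_pos_of_pos (NNReal.coe_pos.2 ht) β
  refine lt_add_of_pos_right _ (div_pos (by linarith) ?_)
  have : 0 < gammaMin := by linarith
  positivity

theorem exists_isRuinExponent {β : ℝ} {t : ℝ≥0} (ht : 0 < t) (hZ : Integrable Z P)
    (hlevel : ∃ ξ : ℝ, 0 < ξ ∧ Integrable (fun ω => Real.exp (ξ * Z ω)) P ∧
      ruinLevel lam β t ≤ rateMgfSum lam Z P ξ) :
    ∃ ξ, IsRuinExponent lam β t Z P ξ := by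
  obtain ⟨b, hb0, hb, hle⟩ := hlevel
  have hcont : ContinuousOn (rateMgfSum lam Z P) (Icc 0 b) :=
    continuousOn_finsetSum _ fun i _ => ((continuousOn_mgf_Icc hZ hb).pow _).const_mul _
  have h0 : rateMgfSum lam Z P 0 < ruinLevel lam β t := by
    simpa [rateMgfSum] using sum_lt_ruinLevel (lam := lam) (β := β) ht
  obtain ⟨ξ, hξ, heq⟩ := intermediate_value_Icc hb0.le hcont ⟨h0.le, hle⟩
  have hξ0 : ξ ≠ 0 := by
    rintro rfl
    exact h0.ne heq
  exact ⟨ξ, lt_of_le_of_ne hξ.1 hξ0.symm, integrable_exp_mul_of_le_right hZ hξ.1 hξ.2 hb, heq⟩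

theorem IsRuinExponent.unique (hk : 1 ≤ k) (hlam : ∀ i, 0 < lam i) (hZ : Integrable Z P)
    (hmean : 0 < ∫ ω, Z ω ∂P) {β : ℝ} {t : ℝ≥0} {a b : ℝ} (ha : IsRuinExponent lam β t Z P a)
    (hb : IsRuinExponent lam β t Z P b) : a = b := by
  rcases lt_trichotomy a b with h | h | h
  · exact absurd (ha.2.2.trans hb.2.2.symm) (rateMgfSum_lt hk hlam hZ hmean ha.1 h hb.2.1).ne
  · exact h
  · exact absurd (hb.2.2.trans ha.2.2.symm) (rateMgfSum_lt hk hlam hZ hmean hb.1 h ha.2.1).ne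

end RuinExponent

/-! ### The ruin probability -/

section Ruin

variable {Ω : Type*} [MeasurableSpace Ω] {P : Measure Ω} [IsProbabilityMeasure P] {β : ℝ} {k : ℕ}
  {lam : Fin k → ℝ≥0} {N : ℝ≥0 → Ω → ℕ} {S : ℝ≥0 → Ω → ℝ} {Y : ℕ → Ω → ℝ}

theorem ae_gfcp_le (hN : IsGCP lam N P) (hS : IsStableSubordinator β S P) (t : ℝ≥0) :
    ∀ᵐ ω ∂P, ∀ s ≤ t, gfcp N S s ω ≤ gfcp N S t ω := by
  filter_upwards [hN.monotone, hS.ae_exists_lt t] with ω h1 h2 s hst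
  -- Only the passage above level `t` must be finite, so one null set serves all `s ≤ t`.
  refine h1 (csInf_le_csInf (OrderBot.bddBelow _) h2 fun r hr => ?_)
  exact lt_of_le_of_lt (NNReal.coe_le_coe.2 hst) hr

theorem gfcp_ae_eq (hS : IsStableSubordinator β S P) (t : ℝ≥0) :
    gfcp N S t =ᵐ[P] fun ω => N (rationalPassage t fun r => S r ω) ω := by
  filter_upwards [hS.inverse_ae_eq t] with ω h
  rw [gfcp, h]

theorem measurable_passage (hS : ∀ r, Measurable (S r)) (t : ℝ≥0) :
    Measurable fun ω => rationalPassage t fun r => S r ω :=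
  (measurable_rationalPassage t).comp (measurable_pi_lambda _ hS)

theorem aemeasurable_gfcp (hN : IsGCP lam N P) (hS : IsStableSubordinator β S P) (t : ℝ≥0) :
    AEMeasurable (gfcp N S t) P :=
  (hN.aemeasurable_comp (measurable_passage hS.measurable t)).congr (gfcp_ae_eq hS t).symm

theorem lintegral_pow_gfcp_le (hN : IsGCP lam N P) (hS : IsStableSubordinator β S P)
    (hNS : IndepFun (fun ω t => N t ω) (fun ω t => S t ω) P) (t : ℝ≥0) {h : ℝ} (hh : 1 ≤ h) :
    ∫⁻ ω, ENNReal.ofReal (h ^ gfcp N S t ω) ∂P ≤ ∫⁻ ω, ENNReal.ofReal (Real.exp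
      ((∑ i : Fin k, (lam i : ℝ) * (h ^ ((i : ℕ) + 1) - 1)) * inverseSubordinator S t ω)) ∂P := by
  have h1 : (fun ω => ENNReal.ofReal (h ^ gfcp N S t ω)) =ᵐ[P] fun ω =>
      ENNReal.ofReal (h ^ N (rationalPassage t fun r => S r ω) ω) := by
    filter_upwards [gfcp_ae_eq hS t] with ω hω
    rw [hω]
  rw [lintegral_congr_ae h1]
  refine (hN.lintegral_pow_comp_le (measurable_passage hS.measurable t)
    (hNS.comp measurable_id (measurable_rationalPassage t)) hh).trans_eq (lintegral_congr_ae ?_)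
  filter_upwards [hS.inverse_ae_eq t] with ω hω
  rw [hω]

/-- Splitting over the values of `M`, independent of the claims, averages the bound for a fixed
number of steps. -/
theorem measure_lt_stoppedSum_random_le {M : Ω → ℕ} (hM : AEMeasurable M P)
    (hYmeas : ∀ j, Measurable (Y j)) (hYindep : iIndepFun Y P)
    (hYM : IndepFun (fun ω j => Y j ω) M P) {ξ h : ℝ} (hξ : 0 < ξ) (hh : 1 ≤ h)
    (hH : ∀ j, ∫⁻ ω, ENNReal.ofReal (Real.exp (ξ * Y j ω)) ∂P = ENNReal.ofReal h) (u : ℝ) :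
    P {ω | u < stoppedSum u (fun j => Y j ω) (M ω)} ≤
      ENNReal.ofReal (Real.exp (-u * ξ)) * ∫⁻ ω, ENNReal.ofReal (h ^ M ω) ∂P := by
  have hsub : {ω | u < stoppedSum u (fun j => Y j ω) (M ω)} ⊆
      ⋃ m : ℕ, {ω | u < stoppedSum u (fun j => Y j ω) m} ∩ M ⁻¹' {m} :=
    fun ω hω => mem_iUnion.2 ⟨M ω, hω, rfl⟩
  have hterm : ∀ m : ℕ, P ({ω | u < stoppedSum u (fun j => Y j ω) m} ∩ M ⁻¹' {m}) ≤
      ENNReal.ofReal (Real.exp (-u * ξ)) * (ENNReal.ofReal (h ^ m) * P.map M {m}) := by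
    intro m
    have hind := (hYM.comp (measurable_stoppedSum u m) measurable_id).measure_inter_preimage_eq_mul
      (Ioi u) {m} measurableSet_Ioi (measurableSet_singleton m)
    refine (le_of_eq hind).trans ?_
    rw [Measure.map_apply_of_aemeasurable hM (measurableSet_singleton m), ← mul_assoc,
      ENNReal.ofReal_pow (zero_le_one.trans hh)]
    refine mul_le_mul_left ?_ _
    exact measure_lt_stoppedSum_le hYmeas hYindep hξ (ENNReal.one_le_ofReal.2 hh) hH u m
  calc P {ω | u < stoppedSum u (fun j => Y j ω) (M ω)}
      ≤ ∑' m : ℕ, P ({ω | u < stoppedSum u (fun j => Y j ω) m} ∩ M ⁻¹' {m}) :=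
        (measure_mono hsub).trans (measure_iUnion_le _)
    _ ≤ ∑' m : ℕ, ENNReal.ofReal (Real.exp (-u * ξ)) * (ENNReal.ofReal (h ^ m) * P.map M {m}) :=
        ENNReal.tsum_le_tsum hterm
    _ = _ := by
        rw [ENNReal.tsum_mul_left, ← lintegral_countable',
          lintegral_map' (by fun_prop) hM]

theorem measure_ruin_le (hN : IsGCP lam N P) (hS : IsStableSubordinator β S P)
    (hYmeas : ∀ j, Measurable (Y j)) (hYindep : iIndepFun Y P)
    (hYN : IndepFun (fun ω j => Y j ω) (fun ω t => gfcp N S t ω) P) {η : ℝ} (hη : 0 ≤ η)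
    (t : ℝ≥0) {ξ h : ℝ} (hξ : 0 < ξ) (hh : 1 ≤ h)
    (hH : ∀ j, ∫⁻ ω, ENNReal.ofReal (Real.exp (ξ * Y j ω)) ∂P = ENNReal.ofReal h) (u : ℝ) :
    P {ω | ∃ s ≤ t, riskProcess u η (gfcp N S) Y s ω < 0} ≤
      ENNReal.ofReal (Real.exp (-u * ξ)) * ∫⁻ ω, ENNReal.ofReal (h ^ gfcp N S t ω) ∂P := by
  -- Almost sure inclusion suffices, so measurability of the ruin event, a union over uncountably
  -- many times, plays no role.
  refine le_trans (measure_mono_ae ?_) (measure_lt_stoppedSum_random_le (aemeasurable_gfcp hN hS t)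
    hYmeas hYindep (hYN.comp measurable_id (measurable_pi_apply t)) hξ hh hH u)
  filter_upwards [ae_gfcp_le hN hS t] with ω hω
  rintro ⟨s, hst, hs⟩
  refine lt_stoppedSum_of_lt_sum (hω s hst) ?_
  rw [riskProcess] at hs
  have : 0 ≤ η * s := mul_nonneg hη s.coe_nonneg
  linarith

theorem IsRuinExponent.lintegral_pow_gfcp_le_two (hβ : 0 < β) (hN : IsGCP lam N P)
    (hS : IsStableSubordinator β S P)
    (hNS : IndepFun (fun ω t => N t ω) (fun ω t => S t ω) P) {t : ℝ≥0} (ht : 0 < t) {Z : Ω → ℝ}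
    {ξ : ℝ} (hξ : IsRuinExponent lam β t Z P ξ) (hone : 1 ≤ mgf Z P ξ) :
    ∫⁻ ω, ENNReal.ofReal (mgf Z P ξ ^ gfcp N S t ω) ∂P ≤ ENNReal.ofReal 2 := by
  have hg := half_lt_gammaMin
  have hg0 : 0 < gammaMin := by linarith
  have ht' : (0 : ℝ) < (t : ℝ) ^ β := Real.rpow_pos_of_pos (NNReal.coe_pos.2 ht) β
  have hc : ∑ i : Fin k, (lam i : ℝ) * (mgf Z P ξ ^ ((i : ℕ) + 1) - 1) =
      (2 * gammaMin - 1) / (2 * (t : ℝ) ^ β * gammaMin) := by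
    have h := hξ.2.2
    rw [rateMgfSum, ruinLevel] at h
    simp only [mul_sub, mul_one, Finset.sum_sub_distrib]
    linarith
  have h1 := lintegral_pow_gfcp_le hN hS hNS t hone
  rw [hc] at h1
  set c := (2 * gammaMin - 1) / (2 * (t : ℝ) ^ β * gammaMin) with hcdef
  have hc0 : 0 ≤ c := div_nonneg (by linarith) (by positivity)
  -- The level is chosen for this identity: the geometric bound becomes `2 Γ(y₀) / Γ(y₀) = 2`.
  have hct : 1 - c * (t : ℝ) ^ β = 1 / (2 * gammaMin) := by
    rw [hcdef]
    field_simp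
    ring
  have hct1 : c * (t : ℝ) ^ β < 1 := by
    have : 0 < 1 / (2 * gammaMin) := by positivity
    linarith
  refine (h1.trans (hS.lintegral_exp_inverse_le hβ hc0 hct1)).trans_eq ?_
  rw [hct]
  congr 1
  field_simp

end Ruin

theorem mainTheorem6 {Ω : Type*} [MeasurableSpace Ω] (P : Measure Ω) [IsProbabilityMeasure P]
    (β : ℝ) (hβ0 : 0 < β) (hβ1 : β < 1)
    (k : ℕ) (hk : 1 ≤ k) (lam : Fin k → ℝ≥0) (hlam : ∀ i, 0 < lam i)
    (N : ℝ≥0 → Ω → ℕ) (hN : IsGCP lam N P)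
    (S : ℝ≥0 → Ω → ℝ) (hS : IsStableSubordinator β S P)
    (hNS : IndepFun (fun ω t => N t ω) (fun ω t => S t ω) P)
    (Y : ℕ → Ω → ℝ) (hYmeas : ∀ j, Measurable (Y j)) (hYindep : iIndepFun Y P)
    (hYident : ∀ j, IdentDistrib (Y j) (Y 0) P P)
    (hYvar : MemLp (Y 0) 2 P) (hYmean : 0 < ∫ ω, Y 0 ω ∂P)
    (hYN : IndepFun (fun ω j => Y j ω) (fun ω t => gfcp N S t ω) P)
    (hlight : IsLightTailed (Y 0) P)
    (η : ℝ) (hη : 0 < η) (t : ℝ≥0) (ht : 0 < t)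
    -- the level is attained, which is automatic if the moment generating function is unbounded
    (hlevel : ∃ ξ : ℝ, 0 < ξ ∧ Integrable (fun ω => Real.exp (ξ * Y 0 ω)) P ∧
      ruinLevel lam β t ≤ rateMgfSum lam (Y 0) P ξ) :
    ∃ ξ₀ : ℝ, IsRuinExponent lam β t (Y 0) P ξ₀ ∧
      (∀ ξ, IsRuinExponent lam β t (Y 0) P ξ → ξ = ξ₀) ∧
      ∀ u : ℝ, 0 ≤ u → 1 / 2 * ruinProb P η (gfcp N S) Y u t ≤ Real.exp (-u * ξ₀) := by
  have hY : Integrable (Y 0) P := hYvar.integrable one_le_two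
  obtain ⟨ξ, hξ⟩ := exists_isRuinExponent ht hY hlevel
  refine ⟨ξ, hξ, fun a ha => ha.unique hk hlam hY hYmean hξ, fun u _ => ?_⟩
  have hone := (one_lt_mgf hY hYmean hξ.1 hξ.2.1).le
  have hH : ∀ j, ∫⁻ ω, ENNReal.ofReal (Real.exp (ξ * Y j ω)) ∂P =
      ENNReal.ofReal (mgf (Y 0) P ξ) := by
    intro j
    have h := ((hYident j).comp
      (show Measurable fun x : ℝ => ENNReal.ofReal (Real.exp (ξ * x)) by fun_prop)).lintegral_eq
    simp only [Function.comp_def] at h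
    rw [h, mgf, ofReal_integral_eq_lintegral_ofReal hξ.2.1
      (Filter.Eventually.of_forall fun ω => (Real.exp_pos _).le)]
  have hP : ruinProb P η (gfcp N S) Y u t ≤ Real.exp (-u * ξ) * 2 := by
    refine ENNReal.toReal_le_of_le_ofReal (by positivity) ?_
    rw [ENNReal.ofReal_mul (Real.exp_pos _).le]
    exact (measure_ruin_le hN hS hYmeas hYindep hYN hη.le t hξ.1 hone hH u).trans
      (mul_le_mul_right (hξ.lintegral_pow_gfcp_le_two hβ0 hN hS hNS ht hone) _)
  linarith
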